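/- Let $m,n$ be nonnegative integers with $n-m\ge 1$, and let $\mathbf G = G_0+G_1\mathbf i+G_2\mathbf j+G_3\mathbf k$ be an $m\times n$ quaternion random matrix, where $G_0,G_1,G_2,G_3$ are $m\times n$ real random matrices whose $4mn$ entries are jointly independent standard normal $N(0,1)$ random variables. Let $\mathbf G^\dagger$ denote the Moore--Penrose pseudoinverse of $\mathbf G$, that is, the unique $n\times m$ quaternion matrix $\mathbf X$ with $\mathbf{GXG}=\mathbf G$, $\mathbf{XGX}=\mathbf X$, $(\mathbf{GX})^*=\mathbf{GX}$, $(\mathbf{XG})^*=\mathbf{XG}$, where ${}^*$ is the quaternion conjugate transpose, and let $\|\mathbf A\|_F=\big(\sum_{i,j}|\mathbf a_{ij}|^2\big)^{1/2}$ denote the Frobenius norm. Then for every real $t\ge 1$, $$ \mathsf P\left\{\|\mathbf G^\dagger\|_F^2>\frac{3m}{4(n-m+1)}\,t\right\}\le t^{-2(n-m)} . $$ -/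

import Mathlib

open MeasureTheory ProbabilityTheory
open scoped Quaternion Matrix

-- `‖A‖` of a matrix is the Frobenius norm from here on.
open scoped Matrix.Norms.Frobenius

namespace QuaternionGaussian

/-- `X` is a Moore-Penrose inverse of the quaternion matrix `A`
(the four Penrose equations; `ᴴ` is the quaternion conjugate transpose). -/
structure IsPseudoinverse {m n : ℕ} (A : Matrix (Fin m) (Fin n) ℍ[ℝ])
    (X : Matrix (Fin n) (Fin m) ℍ[ℝ]) : Prop where
  mul_mul_self : A * X * A = A
  self_mul_mul : X * A * X = X
  left_hermitian : (A * X)ᴴ = A * X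
  right_hermitian : (X * A)ᴴ = X * A

theorem eq_zero_of_conjTranspose_mul_self {m n : ℕ} {M : Matrix (Fin m) (Fin n) ℍ[ℝ]}
    (h : Mᴴ * M = 0) : M = 0 := by
  ext1 i j
  have h1 : (Mᴴ * M) j j = 0 := by rw [h]; rfl
  rw [Matrix.mul_apply] at h1
  simp only [Matrix.conjTranspose_apply, Quaternion.star_mul_self] at h1
  have h2 : ∑ k, Quaternion.normSq (M k j) = 0 := by
    rw [← Quaternion.coe_inj, ← Quaternion.algebraMap_def, map_sum]
    simpa using h1
  rw [Finset.sum_eq_zero_iff_of_nonneg (fun k _ => Quaternion.normSq_nonneg)] at h2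
  simpa using h2 i (Finset.mem_univ i)

/-- Every quaternion matrix has an inner generalized inverse. -/
theorem exists_mul_mul_self {m n : ℕ} (A : Matrix (Fin m) (Fin n) ℍ[ℝ]) :
    ∃ X : Matrix (Fin n) (Fin m) ℍ[ℝ], A * X * A = A := by
  set f := Matrix.toLinearMapRight' A with hf
  obtain ⟨s, hs⟩ := f.rangeRestrict.exists_rightInverse_of_surjective f.range_rangeRestrict
  obtain ⟨g, hg⟩ := LinearMap.exists_extend s
  refine ⟨Matrix.toLinearMapRight'.symm g, Matrix.toLinearMapRight'.injective ?_⟩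
  rw [Matrix.toLinearMapRight'_mul, Matrix.toLinearMapRight'_mul,
    LinearEquiv.apply_symm_apply, ← hf]
  ext1 i
  ext1
  have h1 : ∀ v, g (f v) = s (f.rangeRestrict v) := fun v =>
    congrArg (fun l => l (f.rangeRestrict v)) hg
  have h2 : ∀ v, f (s (f.rangeRestrict v)) = f v := fun v =>
    congrArg (fun l => ((l (f.rangeRestrict v) : LinearMap.range f) : Fin n → ℍ[ℝ])) hs
  simp [h1, h2]

theorem conjTranspose_mul_cancel {m n k : ℕ} {A : Matrix (Fin m) (Fin n) ℍ[ℝ]}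
    {B C : Matrix (Fin n) (Fin k) ℍ[ℝ]} (h : Aᴴ * A * B = Aᴴ * A * C) : A * B = A * C := by
  rw [← sub_eq_zero, ← Matrix.mul_sub]
  apply eq_zero_of_conjTranspose_mul_self
  rw [Matrix.conjTranspose_mul, Matrix.mul_assoc, ← Matrix.mul_assoc Aᴴ, Matrix.mul_sub, h,
    sub_self, Matrix.mul_zero]

/-- There is a matrix `Y` with `A Y A = A` and `A Y` Hermitian. -/
theorem exists_left_hermitian {m n : ℕ} (A : Matrix (Fin m) (Fin n) ℍ[ℝ]) :
    ∃ Y : Matrix (Fin n) (Fin m) ℍ[ℝ], A * Y * A = A ∧ (A * Y)ᴴ = A * Y := by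
  obtain ⟨X, hX⟩ := exists_mul_mul_self (Aᴴ * A)
  have h1 : A * (X * (Aᴴ * A)) = A * (1 : Matrix (Fin n) (Fin n) ℍ[ℝ]) := conjTranspose_mul_cancel (by
    rw [← Matrix.mul_assoc, hX, Matrix.mul_one])
  have h2 : A * (X * Aᴴ) * A = A := by
    rw [Matrix.mul_one] at h1
    rw [Matrix.mul_assoc, Matrix.mul_assoc X, h1]
  refine ⟨X * Aᴴ, h2, ?_⟩
  -- with `H = A Y` one has `Hᴴ H = Hᴴ`, hence `H` is Hermitian
  have h3 : A * (X * Aᴴ) * (A * (X * Aᴴ))ᴴ = (A * (X * Aᴴ))ᴴ := by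
    have h4 : (A * (X * Aᴴ))ᴴ = A * (Xᴴ * Aᴴ) := by
      simp [Matrix.conjTranspose_mul, Matrix.mul_assoc]
    rw [h4, ← Matrix.mul_assoc, h2]
  have h5 := congrArg Matrix.conjTranspose h3
  rw [Matrix.conjTranspose_mul, Matrix.conjTranspose_conjTranspose] at h5
  exact h3.symm.trans h5

theorem exists_isPseudoinverse {m n : ℕ} (A : Matrix (Fin m) (Fin n) ℍ[ℝ]) :
    ∃ X, IsPseudoinverse A X := by
  obtain ⟨Y, hY1, hY2⟩ := exists_left_hermitian A
  obtain ⟨W, hW1, hW2⟩ := exists_left_hermitian Aᴴ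
  have hZ1 : A * Wᴴ * A = A := by
    simpa [Matrix.conjTranspose_mul, Matrix.mul_assoc] using congrArg Matrix.conjTranspose hW1
  have hZ2 : (Wᴴ * A)ᴴ = Wᴴ * A := by
    rw [Matrix.conjTranspose_mul, Matrix.conjTranspose_conjTranspose, ← hW2,
      Matrix.conjTranspose_mul, Matrix.conjTranspose_conjTranspose]
  have e1 : A * (Wᴴ * A * Y) = A * Y := by
    rw [← Matrix.mul_assoc, ← Matrix.mul_assoc, hZ1]
  have e2 : Wᴴ * A * Y * A = Wᴴ * A := by
    rw [Matrix.mul_assoc, Matrix.mul_assoc, ← Matrix.mul_assoc A, hY1]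
  refine ⟨Wᴴ * A * Y, ?_, ?_, ?_, ?_⟩
  · rw [e1, hY1]
  · rw [e2, Matrix.mul_assoc Wᴴ A (Wᴴ * A * Y), e1, Matrix.mul_assoc]
  · rw [e1, hY2]
  · rw [e2, hZ2]

theorem IsPseudoinverse.unique {m n : ℕ} {A : Matrix (Fin m) (Fin n) ℍ[ℝ]}
    {X Y : Matrix (Fin n) (Fin m) ℍ[ℝ]} (hX : IsPseudoinverse A X) (hY : IsPseudoinverse A Y) :
    X = Y := by
  have e1 : A * X = A * Y := by
    calc A * X = (A * Y * A * X)ᴴ := by rw [hY.mul_mul_self, hX.left_hermitian]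
      _ = (A * X)ᴴ * (A * Y)ᴴ := by rw [← Matrix.conjTranspose_mul, Matrix.mul_assoc (A * Y)]
      _ = A * X * A * Y := by
        rw [hX.left_hermitian, hY.left_hermitian, Matrix.mul_assoc (A * X)]
      _ = A * Y := by rw [hX.mul_mul_self]
  have e2 : X * A = Y * A := by
    calc X * A = (X * (A * Y * A))ᴴ := by rw [hY.mul_mul_self, hX.right_hermitian]
      _ = (X * A * (Y * A))ᴴ := by simp only [Matrix.mul_assoc]
      _ = Y * A * (X * A) := by
        rw [Matrix.conjTranspose_mul, hX.right_hermitian, hY.right_hermitian]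
      _ = Y * (A * X * A) := by simp only [Matrix.mul_assoc]
      _ = Y * A := by rw [hX.mul_mul_self]
  calc X = X * A * X := hX.self_mul_mul.symm
    _ = Y * (A * X) := by rw [e2, Matrix.mul_assoc]
    _ = Y * A * Y := by rw [e1, Matrix.mul_assoc]
    _ = Y := hY.self_mul_mul

/-- The Moore-Penrose pseudoinverse of a quaternion matrix. -/
noncomputable def pinv {m n : ℕ} (A : Matrix (Fin m) (Fin n) ℍ[ℝ]) :
    Matrix (Fin n) (Fin m) ℍ[ℝ] :=
  (exists_isPseudoinverse A).choose

theorem isPseudoinverse_pinv {m n : ℕ} (A : Matrix (Fin m) (Fin n) ℍ[ℝ]) :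
    IsPseudoinverse A (pinv A) :=
  (exists_isPseudoinverse A).choose_spec

/-- `G = G₀ + G₁ i + G₂ j + G₃ k` is a quaternion Gaussian random matrix: the `4 m n` real entries
of `G₀, G₁, G₂, G₃` are (jointly) independent `N(0,1)` random variables. -/
structure IsQuaternionGaussian {Ω : Type*} [MeasurableSpace Ω] (P : Measure Ω) {m n : ℕ}
    (G : Ω → Matrix (Fin m) (Fin n) ℍ[ℝ]) : Prop where
  hasLaw : ∀ (c : Fin 4) (i : Fin m) (j : Fin n),
    HasLaw (fun ω => Quaternion.equivTuple ℝ (G ω i j) c) (gaussianReal 0 1) P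
  indep : iIndepFun
    (fun (p : Fin 4 × Fin m × Fin n) (ω : Ω) =>
      Quaternion.equivTuple ℝ (G ω p.2.1 p.2.2) p.1) P

end QuaternionGaussian

/-! Let `X` be the pseudoinverse of `A`. From `Xᴴ = Xᴴ X A`, row `i` of `Xᴴ` is a left combination
of the rows of `A` in which row `i` has coefficient `a`, the squared norm of column `i` of `X`.
Dividing by `a > 0` gives a vector of squared norm `1/a` that is row `i` plus a combination of the
other rows, so `a` is at most the inverse squared distance of row `i` to their span
(`IsPseudoinverse.norm_col_sq_le`). No rank assumption is needed, since the bound may be `⊤`.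

The other `m - 1` rows span real dimension at most `4(m-1)`. Given them, the squared distance
dominates a `χ²` variable with at least `4(n-m+1)` degrees of freedom. Its inverse moment of order
`p = 2(n-m)` is at most `2⁻ᵖ/(p+1)!` (`lintegral_inv_distSq_row_pow_le`), which is at most
`(3/(4(n-m+1)))ᵖ`. The power mean inequality over the `m` columns, then Markov's inequality for the
`p`-th power, give the tail `t⁻ᵖ`. -/

namespace QuaternionGaussian

open Set Filter Topology Module
open scoped ENNReal RealInnerProductSpace Nat

/-! ### Projections of Gaussian vectors and their Laplace transforms -/

section StandardGaussian

variable {E : Type*} [NormedAddCommGroup E] [InnerProductSpace ℝ E] [FiniteDimensional ℝ E]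
  [MeasurableSpace E] [BorelSpace E]

/-- The orthogonal projection of a standard Gaussian vector is a standard Gaussian vector. -/
theorem stdGaussian_map_orthogonalProjection (K : Submodule ℝ E) :
    (stdGaussian E).map K.orthogonalProjectionOnto = stdGaussian K := by
  have : IsProbabilityMeasure ((stdGaussian E).map K.orthogonalProjectionOnto) :=
    Measure.isProbabilityMeasure_map (by fun_prop)
  apply Measure.ext_of_charFun
  ext t
  have h : charFun ((stdGaussian E).map K.orthogonalProjectionOnto) t
      = charFun (stdGaussian E) (t : E) := by
    rw [charFun_apply, charFun_apply, integral_map (by fun_prop) (by fun_prop)]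
    congr 1 with x
    rw [Submodule.coe_inner, Submodule.coe_orthogonalProjectionOnto_apply,
      Submodule.inner_starProjection_left_eq_right, Submodule.starProjection_eq_self_iff.2 t.2]
  rw [h, charFun_stdGaussian, charFun_stdGaussian, Submodule.coe_norm]

theorem integral_exp_neg_mul_sq_gaussianReal {s : ℝ} (hs : 0 ≤ s) :
    ∫ x, Real.exp (-s * x ^ 2) ∂(gaussianReal 0 1) = (√(1 + 2 * s))⁻¹ := by
  rw [integral_gaussianReal_eq_integral_smul one_ne_zero]
  have h : ∀ x : ℝ, gaussianPDFReal 0 1 x • Real.exp (-s * x ^ 2)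
      = (√(2 * Real.pi))⁻¹ * Real.exp (-(1 / 2 + s) * x ^ 2) := by
    intro x
    rw [gaussianPDFReal, smul_eq_mul, mul_assoc, ← Real.exp_add]
    simp only [NNReal.coe_one, mul_one, sub_zero]
    congr 2
    ring
  simp_rw [h]
  rw [integral_const_mul, integral_gaussian, ← Real.sqrt_inv, ← Real.sqrt_inv,
    ← Real.sqrt_mul (by positivity)]
  congr 1
  field_simp

theorem integral_exp_neg_mul_norm_sq_stdGaussian {s : ℝ} (hs : 0 ≤ s) :
    ∫ x, Real.exp (-s * ‖x‖ ^ 2) ∂(stdGaussian E) = (√(1 + 2 * s))⁻¹ ^ finrank ℝ E := by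
  rw [stdGaussian, integral_map (Measurable.aemeasurable (by fun_prop))
    (Measurable.aestronglyMeasurable (by fun_prop))]
  have h : ∀ x : Fin (finrank ℝ E) → ℝ,
      Real.exp (-s * ‖∑ i, x i • stdOrthonormalBasis ℝ E i‖ ^ 2)
        = ∏ i, Real.exp (-s * x i ^ 2) := by
    intro x
    rw [← Real.exp_sum, ← Finset.mul_sum, ← (stdOrthonormalBasis ℝ E).sum_sq_inner_right]
    congr 3 with i
    simp [inner_sum, inner_smul_right, (stdOrthonormalBasis ℝ E).inner_eq_ite]
  simp_rw [h]
  rw [integral_fintype_prod_eq_prod (f := fun (_ : Fin (finrank ℝ E)) x ↦ Real.exp (-s * x ^ 2))]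
  rw [Finset.prod_const, integral_exp_neg_mul_sq_gaussianReal hs, Finset.card_univ, Fintype.card_fin]

/-- Each dimension contributes a factor `(1 + 2s)^(-1/2) ≤ 1`, so a lower bound on the dimension
suffices. The rows spanning `Kᗮ` in the application need not be independent. -/
theorem lintegral_exp_neg_mul_orthogonalProjection_le (K : Submodule ℝ E) {r : ℕ}
    (hK : 2 * r ≤ finrank ℝ K) {s : ℝ} (hs : 0 ≤ s) :
    ∫⁻ x, ENNReal.ofReal (Real.exp (-(s * ‖K.orthogonalProjectionOnto x‖ ^ 2))) ∂(stdGaussian E)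
      ≤ ENNReal.ofReal ((1 + 2 * s)⁻¹ ^ r) := by
  have h : ∫⁻ x, ENNReal.ofReal (Real.exp (-(s * ‖K.orthogonalProjectionOnto x‖ ^ 2)))
        ∂(stdGaussian E)
      = ∫⁻ y, ENNReal.ofReal (Real.exp (-s * ‖y‖ ^ 2)) ∂(stdGaussian K) := by
    rw [← stdGaussian_map_orthogonalProjection, lintegral_map (by fun_prop) (by fun_prop)]
    simp only [neg_mul]
  have hint : Integrable (fun y : K ↦ Real.exp (-s * ‖y‖ ^ 2)) (stdGaussian K) := by
    refine Integrable.of_bound (by fun_prop) 1 (ae_of_all _ fun y ↦ ?_)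
    rw [Real.norm_eq_abs, Real.abs_exp, Real.exp_le_one_iff]
    have := mul_nonneg hs (sq_nonneg ‖y‖)
    linarith
  rw [h, ← ofReal_integral_eq_lintegral_ofReal hint (ae_of_all _ fun y ↦ (Real.exp_pos _).le),
    integral_exp_neg_mul_norm_sq_stdGaussian hs]
  apply ENNReal.ofReal_le_ofReal
  have h1 : (1 : ℝ) ≤ √(1 + 2 * s) := Real.one_le_sqrt.2 (by linarith)
  calc (√(1 + 2 * s))⁻¹ ^ finrank ℝ K ≤ (√(1 + 2 * s))⁻¹ ^ (2 * r) :=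
        pow_le_pow_of_le_one (by positivity) (inv_le_one_of_one_le₀ h1) hK
    _ = (1 + 2 * s)⁻¹ ^ r := by
        rw [pow_mul, inv_pow, Real.sq_sqrt (by linarith)]

end StandardGaussian

/-! ### Inverse moments from the Laplace transform -/

section InverseMoments

/-- With `u = s/(1+2s)` one has `du = (1+2s)⁻² ds` and `(1+2s)⁻¹ = 1 - 2u`, so the integrand becomes
`u^q (1 - 2u) du` on `(0, 1/2)`. -/
theorem integral_pow_mul_inv_pow (q : ℕ) :
    IntegrableOn (fun s : ℝ ↦ s ^ q * (1 + 2 * s)⁻¹ ^ (q + 3)) (Ioi 0) ∧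
    ∫ s in Ioi (0 : ℝ), s ^ q * (1 + 2 * s)⁻¹ ^ (q + 3)
      = (1 / 2) ^ (q + 1) / ((q + 1) * (q + 2)) := by
  set g : ℝ → ℝ := fun s ↦ (s / (1 + 2 * s)) ^ (q + 1) / (q + 1)
    - 2 * (s / (1 + 2 * s)) ^ (q + 2) / (q + 2) with hg
  have hd : ∀ s ∈ Ici (0 : ℝ), HasDerivAt g (s ^ q * (1 + 2 * s)⁻¹ ^ (q + 3)) s := by
    intro s hs
    have hs' : 1 + 2 * s ≠ 0 := by have : (0 : ℝ) ≤ s := hs; positivity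
    have hu : HasDerivAt (fun s : ℝ ↦ s / (1 + 2 * s)) ((1 + 2 * s)⁻¹ ^ 2) s := by
      have h1 : HasDerivAt (fun s : ℝ ↦ 1 + 2 * s) 2 s := by
        simpa using ((hasDerivAt_id s).const_mul 2).const_add 1
      refine ((hasDerivAt_id s).div h1 hs').congr_deriv ?_
      simp only [id]
      field_simp
      ring
    refine (((hu.pow (q + 1)).div_const ((q : ℝ) + 1)).sub
      (((hu.pow (q + 2)).const_mul 2).div_const ((q : ℝ) + 2))).congr_deriv ?_
    have h1 : (q : ℝ) + 1 ≠ 0 := by positivity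
    have h2 : (q : ℝ) + 2 ≠ 0 := by positivity
    rw [Nat.add_sub_cancel, show q + 2 - 1 = q + 1 by omega]
    push_cast
    rw [div_eq_mul_inv s]
    have hv := inv_mul_cancel₀ hs'
    generalize (1 + 2 * s)⁻¹ = v at hv ⊢
    field_simp
    linear_combination -(s * v) ^ q * v ^ 2 * hv
  have hlim : Tendsto g atTop (𝓝 ((1 / 2) ^ (q + 1) / (q + 1) - 2 * (1 / 2) ^ (q + 2) / (q + 2))) := by
    have hu : Tendsto (fun s : ℝ ↦ s / (1 + 2 * s)) atTop (𝓝 (1 / 2)) := by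
      have h1 : Tendsto (fun s : ℝ ↦ (s⁻¹ + 2)⁻¹) atTop (𝓝 ((0 + 2)⁻¹)) :=
        (tendsto_inv_atTop_zero.add_const 2).inv₀ (by norm_num)
      rw [show (1 / 2 : ℝ) = (0 + 2)⁻¹ by norm_num]
      refine h1.congr' ?_
      filter_upwards [eventually_gt_atTop 0] with s hs
      field_simp
    exact ((hu.pow _).div_const _).sub (((hu.pow _).const_mul 2).div_const _)
  have hpos : ∀ s ∈ Ioi (0 : ℝ), 0 ≤ s ^ q * (1 + 2 * s)⁻¹ ^ (q + 3) := by
    intro s hs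
    have : (0 : ℝ) < s := hs
    positivity
  refine ⟨integrableOn_Ioi_deriv_of_nonneg' hd hpos hlim, ?_⟩
  rw [integral_Ioi_of_hasDerivAt_of_nonneg' hd hpos hlim]
  simp only [hg, zero_div, ne_eq, Nat.add_eq_zero_iff, one_ne_zero, and_false, not_false_eq_true,
    zero_pow, OfNat.ofNat_ne_zero]
  field_simp
  ring

/-- This is the Gamma integral. At `r = 0` both sides are `⊤`, so no null set has to be excluded
later. -/
theorem ofReal_inv_pow_mul_factorial (q : ℕ) {r : ℝ} (hr : 0 ≤ r) :
    (ENNReal.ofReal r)⁻¹ ^ (q + 1) * (q ! : ℝ≥0∞)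
      = ∫⁻ s in Ioi (0 : ℝ), ENNReal.ofReal (s ^ q) * ENNReal.ofReal (Real.exp (-(s * r))) := by
  rcases hr.eq_or_lt with rfl | hr
  · have h1 : ∫⁻ s in Ioi (1 : ℝ), (1 : ℝ≥0∞)
        ≤ ∫⁻ s in Ioi (0 : ℝ), ENNReal.ofReal (s ^ q) * ENNReal.ofReal (Real.exp (-(s * 0))) := by
      refine (setLIntegral_mono' measurableSet_Ioi fun s hs ↦ ?_).trans
        (lintegral_mono_set (Ioi_subset_Ioi zero_le_one))
      have : (1 : ℝ) ≤ s ^ q := one_le_pow₀ (le_of_lt hs)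
      simpa using this
    have h2 : (⊤ : ℝ≥0∞) ≤ ∫⁻ s in Ioi (0 : ℝ),
        ENNReal.ofReal (s ^ q) * ENNReal.ofReal (Real.exp (-(s * 0))) := by
      simpa using h1
    rw [top_le_iff.1 h2]
    simp [ENNReal.top_mul, Nat.factorial_ne_zero]
  · have h := Real.integral_rpow_mul_exp_neg_mul_Ioi (a := q + 1) (by positivity) hr
    have hi : ∫ s in Ioi (0 : ℝ), s ^ q * Real.exp (-(s * r)) = r⁻¹ ^ (q + 1) * q ! := by
      rw [Real.Gamma_nat_eq_factorial] at h
      rw [one_div, ← Nat.cast_add_one, Real.rpow_natCast] at h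
      rw [← h]
      refine setIntegral_congr_fun measurableSet_Ioi fun s _ ↦ ?_
      simp [mul_comm]
    have hint : IntegrableOn (fun s : ℝ ↦ s ^ q * Real.exp (-(s * r))) (Ioi 0) := by
      by_contra hc
      rw [integral_undef hc] at hi
      have : 0 < r⁻¹ ^ (q + 1) * (q ! : ℝ) := by positivity
      exact this.ne hi
    have hnn : ∀ s ∈ Ioi (0 : ℝ), ENNReal.ofReal (s ^ q) * ENNReal.ofReal (Real.exp (-(s * r)))
        = ENNReal.ofReal (s ^ q * Real.exp (-(s * r))) := fun s hs ↦
      (ENNReal.ofReal_mul (pow_nonneg (le_of_lt hs) q)).symm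
    rw [setLIntegral_congr_fun measurableSet_Ioi hnn,
      ← ofReal_integral_eq_lintegral_ofReal hint, hi, ENNReal.ofReal_mul (by positivity),
      ENNReal.ofReal_pow (by positivity), ENNReal.ofReal_inv_of_pos hr, ENNReal.ofReal_natCast]
    exact (ae_restrict_mem measurableSet_Ioi).mono fun s hs ↦
      mul_nonneg (pow_nonneg (le_of_lt hs) q) (Real.exp_pos _).le

/-- A bound on the Laplace transform of a nonnegative random variable which holds for a `χ²` variable
with `2 q + 6` degrees of freedom bounds its inverse moment of order `q + 1`. -/
theorem lintegral_inv_pow_le_of_laplace_le {X : Type*} [MeasurableSpace X] {μ : Measure X}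
    [SFinite μ] {S : X → ℝ} (hS : Measurable S) (hS0 : ∀ x, 0 ≤ S x) (q : ℕ)
    (hL : ∀ s : ℝ, 0 ≤ s → ∫⁻ x, ENNReal.ofReal (Real.exp (-(s * S x))) ∂μ
      ≤ ENNReal.ofReal ((1 + 2 * s)⁻¹ ^ (q + 3))) :
    ∫⁻ x, (ENNReal.ofReal (S x))⁻¹ ^ (q + 1) ∂μ
      ≤ ENNReal.ofReal ((1 / 2) ^ (q + 1) / (q + 2)!) := by
  have hq0 : (q ! : ℝ≥0∞) ≠ 0 := by exact_mod_cast Nat.factorial_ne_zero q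
  have hqt : (q ! : ℝ≥0∞) ≠ ⊤ := ENNReal.natCast_ne_top _
  -- The factor `q!` turns the inverse power into a Gamma integral. Tonelli then brings in the
  -- Laplace transform.
  rw [← ENNReal.mul_le_mul_iff_left hq0 hqt]
  calc (∫⁻ x, (ENNReal.ofReal (S x))⁻¹ ^ (q + 1) ∂μ) * (q ! : ℝ≥0∞)
      = ∫⁻ x, (∫⁻ s in Ioi (0 : ℝ),
          ENNReal.ofReal (s ^ q) * ENNReal.ofReal (Real.exp (-(s * S x)))) ∂μ := by
        rw [← lintegral_mul_const' _ _ hqt]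
        exact lintegral_congr fun x ↦ ofReal_inv_pow_mul_factorial q (hS0 x)
    _ = ∫⁻ s in Ioi (0 : ℝ), ∫⁻ x,
          ENNReal.ofReal (s ^ q) * ENNReal.ofReal (Real.exp (-(s * S x))) ∂μ :=
        lintegral_lintegral_swap (Measurable.aemeasurable (by fun_prop))
    _ ≤ ∫⁻ s in Ioi (0 : ℝ), ENNReal.ofReal (s ^ q * (1 + 2 * s)⁻¹ ^ (q + 3)) := by
        refine setLIntegral_mono' measurableSet_Ioi fun s hs ↦ ?_
        rw [lintegral_const_mul' _ _ ENNReal.ofReal_ne_top,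
          ENNReal.ofReal_mul (pow_nonneg (le_of_lt hs) q)]
        gcongr
        exact hL s (le_of_lt hs)
    _ = ENNReal.ofReal ((1 / 2) ^ (q + 1) / ((q + 1) * (q + 2))) := by
        rw [← (integral_pow_mul_inv_pow q).2,
          ofReal_integral_eq_lintegral_ofReal (integral_pow_mul_inv_pow q).1]
        refine (ae_restrict_mem measurableSet_Ioi).mono fun s hs ↦ ?_
        have : (0 : ℝ) < s := hs
        simp only [Pi.zero_apply]
        positivity
    _ = ENNReal.ofReal ((1 / 2) ^ (q + 1) / (q + 2)!) * (q ! : ℝ≥0∞) := by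
        rw [← ENNReal.ofReal_natCast, ← ENNReal.ofReal_mul (by positivity)]
        congr 1
        have : (q ! : ℝ) ≠ 0 := by exact_mod_cast Nat.factorial_ne_zero q
        rw [Nat.factorial_succ, Nat.factorial_succ]
        push_cast
        field_simp
        ring

end InverseMoments

/-! ### Real coordinates and the distance to a quaternion span -/

section RealCoordinates

/-- The real coordinate vector of a quaternion row vector. -/
noncomputable def realVec (n : ℕ) : (Fin n → ℍ[ℝ]) ≃ₗ[ℝ] EuclideanSpace ℝ (Fin 4 × Fin n) where
  toFun v := WithLp.toLp 2 fun p ↦ Quaternion.equivTuple ℝ (v p.2) p.1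
  invFun x j := (Quaternion.equivTuple ℝ).symm fun c ↦ x (c, j)
  map_add' u v := by
    ext ⟨c, j⟩
    fin_cases c <;> simp
  map_smul' a v := by
    ext ⟨c, j⟩
    fin_cases c <;> simp
  left_inv v := by
    ext1 j
    exact (Quaternion.equivTuple ℝ).symm_apply_apply (v j)
  right_inv x := by
    ext ⟨c, j⟩
    exact congrFun ((Quaternion.equivTuple ℝ).apply_symm_apply fun c ↦ x (c, j)) c

theorem norm_realVec_sq {n : ℕ} (v : Fin n → ℍ[ℝ]) : ‖realVec n v‖ ^ 2 = ∑ j, ‖v j‖ ^ 2 := by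
  rw [EuclideanSpace.real_norm_sq_eq, Fintype.sum_prod_type_right]
  refine Finset.sum_congr rfl fun j _ ↦ ?_
  rw [← Quaternion.norm_toLp_equivTuple, EuclideanSpace.real_norm_sq_eq]
  rfl

variable {n : ℕ} {K : Type*} [Fintype K]

/-- The left quaternion linear combination `∑ k, c k • w k`, in real coordinates. -/
noncomputable def leftComb (w : K → EuclideanSpace ℝ (Fin 4 × Fin n)) :
    (K → ℍ[ℝ]) →ₗ[ℝ] EuclideanSpace ℝ (Fin 4 × Fin n) where
  toFun c := ∑ k, realVec n (c k • (realVec n).symm (w k))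
  map_add' c d := by simp [add_smul, Finset.sum_add_distrib]
  map_smul' a c := by simp [Finset.smul_sum, smul_assoc]

theorem leftComb_apply (w : K → EuclideanSpace ℝ (Fin 4 × Fin n)) (c : K → ℍ[ℝ]) :
    leftComb w c = ∑ k, realVec n (c k • (realVec n).symm (w k)) := rfl

theorem continuous_leftComb (c : K → ℍ[ℝ]) :
    Continuous fun w : K → EuclideanSpace ℝ (Fin 4 × Fin n) ↦ leftComb w c := by
  simp only [leftComb_apply]
  refine continuous_finsetSum _ fun k _ ↦ ?_
  have h1 : Continuous (realVec n).symm.toLinearMap := LinearMap.continuous_of_finiteDimensional _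
  have h2 : Continuous (realVec n).toLinearMap := LinearMap.continuous_of_finiteDimensional _
  exact h2.comp ((h1.comp (continuous_apply k)).const_smul (c k))

theorem finrank_range_leftComb_le (w : K → EuclideanSpace ℝ (Fin 4 × Fin n)) :
    finrank ℝ (LinearMap.range (leftComb w)) ≤ 4 * Fintype.card K := by
  refine (LinearMap.finrank_range_le _).trans ?_
  rw [Module.finrank_pi_fintype]
  simp [Quaternion.finrank_eq_four, mul_comm]

/-- The squared distance of `v` to the left quaternion span of the vectors `w k`. -/
noncomputable def distSq (v : EuclideanSpace ℝ (Fin 4 × Fin n))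
    (w : K → EuclideanSpace ℝ (Fin 4 × Fin n)) : ℝ≥0∞ :=
  ⨅ c : K → ℍ[ℝ], ENNReal.ofReal (‖v - leftComb w c‖ ^ 2)

/-- An infimum of continuous functions, even over an uncountable family, is upper semicontinuous. -/
theorem measurable_distSq :
    Measurable fun p : EuclideanSpace ℝ (Fin 4 × Fin n) × (K → EuclideanSpace ℝ (Fin 4 × Fin n)) ↦
      distSq p.1 p.2 := by
  refine (upperSemicontinuous_iInf fun c ↦ Continuous.upperSemicontinuous ?_).measurable
  have h := continuous_leftComb (n := n) c
  exact ENNReal.continuous_ofReal.comp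
    ((continuous_fst.sub (h.comp continuous_snd)).norm.pow 2)

theorem ofReal_norm_orthogonalProjection_sq_le_distSq (v : EuclideanSpace ℝ (Fin 4 × Fin n))
    (w : K → EuclideanSpace ℝ (Fin 4 × Fin n)) :
    ENNReal.ofReal (‖(LinearMap.range (leftComb w))ᗮ.orthogonalProjectionOnto v‖ ^ 2)
      ≤ distSq v w := by
  refine le_iInf fun c ↦ ENNReal.ofReal_le_ofReal ?_
  have h : (LinearMap.range (leftComb w))ᗮ.orthogonalProjectionOnto (leftComb w c) = 0 :=
    Submodule.orthogonalProjectionOnto_orthogonal_apply_eq_zero (LinearMap.mem_range_self _ c)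
  have h2 := (LinearMap.range (leftComb w))ᗮ.norm_orthogonalProjectionOnto_apply_le
    (v - leftComb w c)
  rw [map_sub, h, sub_zero] at h2
  gcongr

end RealCoordinates

/-! ### Columns of the pseudoinverse and distances between rows -/

theorem IsPseudoinverse.conjTranspose_eq {m n : ℕ} {A : Matrix (Fin m) (Fin n) ℍ[ℝ]}
    {X : Matrix (Fin n) (Fin m) ℍ[ℝ]} (h : IsPseudoinverse A X) : Xᴴ = Xᴴ * X * A := by
  conv_lhs => rw [← h.self_mul_mul, Matrix.conjTranspose_mul, h.right_hermitian]
  rw [Matrix.mul_assoc]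

/-- The squared norm of a column of the pseudoinverse is at most the inverse of the squared
distance of the corresponding row to the span of the other rows. -/
theorem IsPseudoinverse.norm_col_sq_le {m n : ℕ} {A : Matrix (Fin m) (Fin n) ℍ[ℝ]}
    {X : Matrix (Fin n) (Fin m) ℍ[ℝ]} (h : IsPseudoinverse A X) (i : Fin m) :
    ENNReal.ofReal (∑ j, ‖X j i‖ ^ 2)
      ≤ (distSq (realVec n (A i)) fun k : {k // k ≠ i} ↦ realVec n (A k))⁻¹ := by
  set a : ℝ := ∑ j, ‖X j i‖ ^ 2 with ha
  have ha0 : 0 ≤ a := by positivity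
  rcases ha0.eq_or_lt with h0 | hpos
  · simp [← h0]
  rw [ENNReal.le_inv_iff_le_inv, ← ENNReal.ofReal_inv_of_pos hpos]
  -- These coefficients come from row `i` of `Xᴴ = Xᴴ X A` divided by its diagonal coefficient `(Xᴴ
  -- X) i i = a`. The remainder is `a⁻¹ • Xᴴ i`, of squared norm `a⁻² a = a⁻¹`.
  refine (iInf_le _ fun k : {k // k ≠ i} ↦ -(a⁻¹ • (Xᴴ * X) i k)).trans
    (ENNReal.ofReal_le_ofReal (le_of_eq ?_))
  have hdiag : (Xᴴ * X) i i = (a : ℍ[ℝ]) := by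
    rw [Matrix.mul_apply, ha, ← Quaternion.algebraMap_def, map_sum]
    refine Finset.sum_congr rfl fun j _ ↦ ?_
    rw [Matrix.conjTranspose_apply, Quaternion.star_mul_self, Quaternion.normSq_eq_norm_mul_self,
      ← sq, Quaternion.algebraMap_def]
  have hrow : realVec n (A i) - leftComb (fun k : {k // k ≠ i} ↦ realVec n (A k))
      (fun k ↦ -(a⁻¹ • (Xᴴ * X) i k)) = realVec n (a⁻¹ • Xᴴ i) := by
    rw [leftComb_apply, ← map_sum, ← map_sub]
    congr 1
    ext1 j
    have hj : Xᴴ i j = ∑ k, (Xᴴ * X) i k * A k j := by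
      conv_lhs => rw [h.conjTranspose_eq, Matrix.mul_apply]
    rw [← Finset.add_sum_erase _ _ (Finset.mem_univ i)] at hj
    have hsub : ∑ k : {k // k ≠ i}, (Xᴴ * X) i k * A k j
        = ∑ k ∈ Finset.univ.erase i, (Xᴴ * X) i k * A k j := by
      rw [← Finset.sum_subtype (Finset.univ.erase i) (by simp) fun k ↦ (Xᴴ * X) i k * A k j]
    rw [hdiag, ← hsub] at hj
    simp only [LinearEquiv.symm_apply_apply, Pi.sub_apply, Finset.sum_apply, Pi.smul_apply,
      smul_eq_mul, neg_mul, smul_mul_assoc, Finset.sum_neg_distrib, sub_neg_eq_add,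
      ← Finset.smul_sum]
    rw [hj, smul_add, Quaternion.coe_mul_eq_smul, smul_smul, inv_mul_cancel₀ hpos.ne', one_smul]
  rw [hrow, map_smul, norm_smul, mul_pow, norm_realVec_sq]
  have hstar : ∑ j, ‖Xᴴ i j‖ ^ 2 = a := by
    simp only [Matrix.conjTranspose_apply, Quaternion.norm_star, ha]
  rw [hstar, Real.norm_eq_abs, sq_abs]
  field_simp

theorem norm_sq_eq_sum_col {m n : ℕ} (X : Matrix (Fin n) (Fin m) ℍ[ℝ]) :
    ‖X‖ ^ 2 = ∑ i, ∑ j, ‖X j i‖ ^ 2 := by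
  rw [Matrix.frobenius_norm_def, ← Real.sqrt_eq_rpow, Real.sq_sqrt (by positivity),
    Finset.sum_comm]
  simp

/-! ### Inverse moments of the row distances -/

theorem lintegral_inv_distSq_pow_le {n : ℕ} {K : Type*} [Fintype K]
    (w : K → EuclideanSpace ℝ (Fin 4 × Fin n)) {q : ℕ}
    (hq : 2 * (q + 3) + 4 * Fintype.card K ≤ 4 * n) :
    ∫⁻ v, (distSq v w)⁻¹ ^ (q + 1) ∂(stdGaussian (EuclideanSpace ℝ (Fin 4 × Fin n)))
      ≤ ENNReal.ofReal ((1 / 2) ^ (q + 1) / (q + 2)!) := by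
  set W := LinearMap.range (leftComb w) with hW
  have hdim : 2 * (q + 3) ≤ finrank ℝ Wᗮ := by
    have h1 := W.finrank_add_finrank_orthogonal
    have h2 : finrank ℝ W ≤ 4 * Fintype.card K := finrank_range_leftComb_le w
    simp only [finrank_euclideanSpace, Fintype.card_prod, Fintype.card_fin] at h1
    omega
  calc ∫⁻ v, (distSq v w)⁻¹ ^ (q + 1) ∂(stdGaussian (EuclideanSpace ℝ (Fin 4 × Fin n)))
      ≤ ∫⁻ v, (ENNReal.ofReal (‖Wᗮ.orthogonalProjectionOnto v‖ ^ 2))⁻¹ ^ (q + 1)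
          ∂(stdGaussian (EuclideanSpace ℝ (Fin 4 × Fin n))) := by
        gcongr with v
        exact ofReal_norm_orthogonalProjection_sq_le_distSq v w
    _ ≤ _ := lintegral_inv_pow_le_of_laplace_le (by fun_prop) (fun _ ↦ by positivity) q
        fun s hs ↦ lintegral_exp_neg_mul_orthogonalProjection_le Wᗮ hdim hs

namespace IsQuaternionGaussian

variable {Ω : Type*} [MeasurableSpace Ω] {P : Measure Ω} {m n : ℕ}
  {G : Ω → Matrix (Fin m) (Fin n) ℍ[ℝ]}

theorem hasLaw_row (hG : IsQuaternionGaussian P G) (i : Fin m) :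
    HasLaw (fun ω ↦ realVec n (G ω i))
      (stdGaussian (EuclideanSpace ℝ (Fin 4 × Fin n))) P := by
  have hg : Function.Injective fun p : Fin 4 × Fin n ↦ ((p.1, i, p.2) : Fin 4 × Fin m × Fin n) := by
    rintro ⟨a, b⟩ ⟨c, d⟩ h
    simpa using h
  have h := (hG.indep.precomp hg).hasLaw_pi (μ := fun _ ↦ gaussianReal 0 1)
    fun p : Fin 4 × Fin n ↦ hG.hasLaw p.1 i p.2
  have h2 : HasLaw (WithLp.toLp 2) (stdGaussian (EuclideanSpace ℝ (Fin 4 × Fin n)))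
      (Measure.pi fun _ ↦ gaussianReal 0 1) :=
    ⟨(WithLp.measurable_toLp 2 _).aemeasurable, map_pi_eq_stdGaussian⟩
  exact h2.comp h

theorem indepFun_row (hG : IsQuaternionGaussian P G) (i : Fin m) :
    IndepFun (fun ω ↦ realVec n (G ω i)) (fun ω (k : {k // k ≠ i}) ↦ realVec n (G ω k)) P := by
  have h := hG.indep.indepFun_finset₀
    (Finset.univ.filter fun p : Fin 4 × Fin m × Fin n ↦ p.2.1 = i)
    (Finset.univ.filter fun p : Fin 4 × Fin m × Fin n ↦ ¬p.2.1 = i)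
    (Finset.disjoint_filter_filter_not _ _ _)
    fun p ↦ (hG.hasLaw p.1 p.2.1 p.2.2).aemeasurable
  have h1 : Measurable fun (x : (Finset.univ.filter fun p : Fin 4 × Fin m × Fin n ↦ p.2.1 = i) → ℝ) ↦
      WithLp.toLp 2 fun p : Fin 4 × Fin n ↦ x ⟨(p.1, i, p.2), by simp⟩ :=
    (WithLp.measurable_toLp 2 _).comp (measurable_pi_lambda _ fun p ↦ measurable_pi_apply _)
  have h2 : Measurable
      fun (x : (Finset.univ.filter fun p : Fin 4 × Fin m × Fin n ↦ ¬p.2.1 = i) → ℝ)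
        (k : {k // k ≠ i}) ↦
      WithLp.toLp 2 fun p : Fin 4 × Fin n ↦ x ⟨(p.1, k, p.2), by simpa using k.2⟩ :=
    measurable_pi_lambda _ fun k ↦ (WithLp.measurable_toLp 2 _).comp
      (measurable_pi_lambda _ fun p ↦ measurable_pi_apply _)
  exact h.comp h1 h2

theorem aemeasurable_rows (hG : IsQuaternionGaussian P G) (i : Fin m) :
    AEMeasurable (fun ω (k : {k // k ≠ i}) ↦ realVec n (G ω k)) P :=
  aemeasurable_pi_lambda _ fun k ↦ (hG.hasLaw_row k).aemeasurable

theorem aemeasurable_distSq (hG : IsQuaternionGaussian P G) (i : Fin m) :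
    AEMeasurable (fun ω ↦ distSq (realVec n (G ω i)) fun k : {k // k ≠ i} ↦ realVec n (G ω k))
      P := by
  have h := (hG.hasLaw_row i).aemeasurable.prodMk (hG.aemeasurable_rows i)
  have h2 := (measurable_distSq (n := n) (K := {k // k ≠ i})).comp_aemeasurable h
  rw [Function.comp_def] at h2
  exact h2

/-- By independence the other rows can be frozen, and the bound for frozen rows does not depend on
their values. -/
theorem lintegral_inv_distSq_row_pow_le [IsProbabilityMeasure P] (hG : IsQuaternionGaussian P G)
    (i : Fin m) {q : ℕ} (hq : 2 * (q + 3) + 4 * m ≤ 4 * n + 4) :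
    ∫⁻ ω, (distSq (realVec n (G ω i)) fun k : {k // k ≠ i} ↦ realVec n (G ω k))⁻¹ ^ (q + 1) ∂P
      ≤ ENNReal.ofReal ((1 / 2) ^ (q + 1) / (q + 2)!) := by
  have hm : 0 < m := i.pos
  have hU := hG.hasLaw_row i
  have hV := hG.aemeasurable_rows i
  have : IsProbabilityMeasure (P.map fun ω (k : {k // k ≠ i}) ↦ realVec n (G ω k)) :=
    Measure.isProbabilityMeasure_map hV
  have hf : Measurable fun p : EuclideanSpace ℝ (Fin 4 × Fin n) ×
      ({k // k ≠ i} → EuclideanSpace ℝ (Fin 4 × Fin n)) ↦ (distSq p.1 p.2)⁻¹ ^ (q + 1) :=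
    (measurable_distSq.inv).pow_const _
  have h := lintegral_map' (μ := P) hf.aemeasurable (hU.aemeasurable.prodMk hV)
  rw [(hG.indepFun_row i).map_prod_eq_prod_map_map hU.aemeasurable hV, hU.map_eq,
    lintegral_prod_symm' _ hf] at h
  rw [← h]
  refine (lintegral_mono fun w ↦ lintegral_inv_distSq_pow_le w (q := q) ?_).trans_eq (by simp)
  simp only [Fintype.card_subtype_compl, Fintype.card_fin, Fintype.card_unique]
  omega

end IsQuaternionGaussian

/-! ### Constants and the tail bound -/

theorem sum_pow_le_card_pow_mul_sum_pow {ι : Type*} (s : Finset ι) (f : ι → ℝ≥0∞) (q : ℕ) :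
    (∑ i ∈ s, f i) ^ (q + 1) ≤ (s.card : ℝ≥0∞) ^ q * ∑ i ∈ s, f i ^ (q + 1) := by
  have h := ENNReal.rpow_sum_le_const_mul_sum_rpow s f (p := (q + 1 : ℕ)) (by simp)
  have e : ((q + 1 : ℕ) : ℝ) - 1 = q := by simp
  rw [e] at h
  simpa only [ENNReal.rpow_natCast] using h

/-- In the induction step the ratio `((k+3)/(k+2))^(k+1)` is at most `e < 3`; this is the source of
the 3 in the final constant. -/
theorem add_two_pow_le (k : ℕ) : ((k : ℝ) + 2) ^ k ≤ 3 ^ k * (k + 1)! := by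
  induction k with
  | zero => simp
  | succ k ih =>
    have hk : (0 : ℝ) < k + 2 := by positivity
    have h1 : ((k : ℝ) + 3) ^ (k + 1) ≤ 3 * ((k : ℝ) + 2) ^ (k + 1) := by
      have h2 : (k : ℝ) + 3 ≤ Real.exp (1 / (k + 2)) * (k + 2) := by
        have := mul_le_mul_of_nonneg_right (Real.add_one_le_exp (1 / ((k : ℝ) + 2))) hk.le
        refine le_trans (le_of_eq ?_) this
        field_simp
        ring
      calc ((k : ℝ) + 3) ^ (k + 1) ≤ (Real.exp (1 / (k + 2)) * (k + 2)) ^ (k + 1) := by gcongr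
        _ = Real.exp ((k + 1) / (k + 2)) * ((k : ℝ) + 2) ^ (k + 1) := by
          rw [mul_pow, ← Real.exp_nat_mul]
          congr 2
          push_cast
          ring
        _ ≤ 3 * ((k : ℝ) + 2) ^ (k + 1) := by
          gcongr
          refine (Real.exp_le_exp.2 ?_).trans Real.exp_one_lt_three.le
          rw [div_le_one hk]
          linarith
    calc (((k + 1 : ℕ) : ℝ) + 2) ^ (k + 1) = ((k : ℝ) + 3) ^ (k + 1) := by push_cast; ring
      _ ≤ 3 * ((k : ℝ) + 2) ^ (k + 1) := h1
      _ = 3 * (k + 2) * (((k : ℝ) + 2) ^ k) := by ring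
      _ ≤ 3 * (k + 2) * (3 ^ k * (k + 1)!) := by gcongr
      _ = 3 ^ (k + 1) * (k + 1 + 1)! := by
        rw [Nat.factorial_succ (k + 1)]
        push_cast
        ring

/-- The inverse moment of order `2 e + 2` of a `χ²` variable with `4 (e + 2)` degrees of freedom, in
the form used for the tail estimate. -/
theorem half_pow_div_factorial_le (e : ℕ) :
    (1 / 2 : ℝ) ^ (2 * e + 2) / (2 * e + 3)! ≤ (3 / (4 * (e + 2))) ^ (2 * e + 2) := by
  have h := add_two_pow_le (2 * e + 2)
  have hf : (0 : ℝ) < (2 * e + 3)! := by positivity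
  have h1 : (3 / (4 * ((e : ℝ) + 2))) ^ (2 * e + 2)
      = (1 / 2) ^ (2 * e + 2) * (3 ^ (2 * e + 2) / (((2 * e + 2 : ℕ) : ℝ) + 2) ^ (2 * e + 2)) := by
    rw [← div_pow, ← mul_pow]
    congr 1
    push_cast
    field_simp
    ring
  rw [h1, div_eq_mul_one_div]
  refine mul_le_mul_of_nonneg_left ?_ (by positivity)
  rw [div_le_div_iff₀ hf (by positivity), one_mul]
  exact h

/-- Tail bound for the squared Frobenius norm of the pseudoinverse of an `m × n` quaternion
Gaussian matrix with `n = m + e + 1`. -/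
theorem IsQuaternionGaussian.measure_norm_pinv_sq_gt_le {Ω : Type*} [MeasurableSpace Ω]
    {P : Measure Ω} [IsProbabilityMeasure P] {m n e : ℕ} (hn : n = m + e + 1)
    {G : Ω → Matrix (Fin m) (Fin n) ℍ[ℝ]} (hG : IsQuaternionGaussian P G)
    {t : ℝ} (ht : 0 < t) :
    P {ω | ‖pinv (G ω)‖ ^ 2 > 3 * m / (4 * (e + 2)) * t} ≤ ENNReal.ofReal ((t ^ (2 * e + 2))⁻¹) := by
  -- For `m = 0` the Markov level would vanish, but the event is empty.
  rcases Nat.eq_zero_or_pos m with rfl | hm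
  · have h0 : {ω | ‖pinv (G ω)‖ ^ 2 > 3 * ((0 : ℕ) : ℝ) / (4 * (e + 2)) * t} = ∅ := by
      ext ω
      simp [norm_sq_eq_sum_col]
    rw [h0, measure_empty]
    exact zero_le
  set D : Fin m → Ω → ℝ≥0∞ := fun i ω ↦
    distSq (realVec _ (G ω i)) fun k : {k // k ≠ i} ↦ realVec _ (G ω k) with hD
  have hDm : ∀ i, AEMeasurable (fun ω ↦ (D i ω)⁻¹) P := fun i ↦ (hG.aemeasurable_distSq i).inv
  set a : ℝ := 3 / (4 * (e + 2)) with ha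
  have ha0 : 0 < a := by positivity
  have hm0 : (0 : ℝ) < m := by exact_mod_cast hm
  have hlevel : 0 < m * a * t := by positivity
  have hbound : ∫⁻ ω, (∑ i, (D i ω)⁻¹) ^ (2 * e + 2) ∂P
      ≤ ENNReal.ofReal ((m * a) ^ (2 * e + 2)) := by
    calc ∫⁻ ω, (∑ i, (D i ω)⁻¹) ^ (2 * e + 2) ∂P
        ≤ ∫⁻ ω, (m : ℝ≥0∞) ^ (2 * e + 1) * ∑ i, (D i ω)⁻¹ ^ (2 * e + 2) ∂P := by
          gcongr with ω
          simpa using sum_pow_le_card_pow_mul_sum_pow Finset.univ (fun i ↦ (D i ω)⁻¹) (2 * e + 1)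
      _ = (m : ℝ≥0∞) ^ (2 * e + 1) * ∑ i, ∫⁻ ω, (D i ω)⁻¹ ^ (2 * e + 2) ∂P := by
          rw [lintegral_const_mul' _ _ (by finiteness),
            lintegral_finsetSum' _ fun i _ ↦ (hDm i).pow_const _]
      _ ≤ (m : ℝ≥0∞) ^ (2 * e + 1) * ∑ i : Fin m, ENNReal.ofReal (a ^ (2 * e + 2)) := by
          gcongr with i
          -- The choice `q = 2e + 1` gives order `2e + 2 = 2(n-m)` and makes the dimension condition
          -- an equality: `2(q+3) = 4(n-m+1)`.
          refine (hG.lintegral_inv_distSq_row_pow_le i (q := 2 * e + 1) (by omega)).trans ?_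
          exact ENNReal.ofReal_le_ofReal (half_pow_div_factorial_le e)
      _ = ENNReal.ofReal ((m * a) ^ (2 * e + 2)) := by
          rw [Finset.sum_const, Finset.card_univ, Fintype.card_fin, nsmul_eq_mul, ← mul_assoc,
            ← pow_succ, mul_pow, ENNReal.ofReal_mul (by positivity),
            ENNReal.ofReal_pow hm0.le, ENNReal.ofReal_natCast]
  -- Passing to a larger event defined by the distances avoids any measurability question about
  -- `pinv`.
  have hsub : {ω | ‖pinv (G ω)‖ ^ 2 > 3 * m / (4 * (e + 2)) * t}
      ⊆ {ω | ENNReal.ofReal ((m * a * t) ^ (2 * e + 2)) ≤ (∑ i, (D i ω)⁻¹) ^ (2 * e + 2)} := by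
    intro ω hω
    rw [mem_ofPred_eq] at hω ⊢
    rw [ENNReal.ofReal_pow hlevel.le]
    gcongr
    calc ENNReal.ofReal (m * a * t) ≤ ENNReal.ofReal (‖pinv (G ω)‖ ^ 2) := by
          apply ENNReal.ofReal_le_ofReal
          rw [ha, mul_div_assoc', mul_comm (m : ℝ) 3]
          exact hω.le
      _ = ∑ i, ENNReal.ofReal (∑ j, ‖pinv (G ω) j i‖ ^ 2) := by
          rw [norm_sq_eq_sum_col, ENNReal.ofReal_sum_of_nonneg fun i _ ↦ by positivity]
      _ ≤ ∑ i, (D i ω)⁻¹ :=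
          Finset.sum_le_sum fun i _ ↦ (isPseudoinverse_pinv (G ω)).norm_col_sq_le i
  have hL : 0 < (m * a * t) ^ (2 * e + 2) := by positivity
  have hmarkov := (mul_meas_ge_le_lintegral₀ (μ := P)
    ((Finset.aemeasurable_fun_sum Finset.univ fun i _ ↦ hDm i).pow_const (2 * e + 2))
    (ENNReal.ofReal ((m * a * t) ^ (2 * e + 2)))).trans hbound
  calc P {ω | ‖pinv (G ω)‖ ^ 2 > 3 * m / (4 * (e + 2)) * t}
      ≤ ENNReal.ofReal ((m * a) ^ (2 * e + 2)) / ENNReal.ofReal ((m * a * t) ^ (2 * e + 2)) := by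
        refine (measure_mono hsub).trans ?_
        rw [ENNReal.le_div_iff_mul_le (Or.inl (by simpa using hL)) (Or.inl ENNReal.ofReal_ne_top),
          mul_comm]
        exact hmarkov
    _ = ENNReal.ofReal ((t ^ (2 * e + 2))⁻¹) := by
        rw [← ENNReal.ofReal_div_of_pos hL, mul_pow _ t]
        congr 1
        field_simp

end QuaternionGaussian

theorem mainTheorem6 {Ω : Type*} [MeasurableSpace Ω] (P : Measure Ω) [IsProbabilityMeasure P]
    (m n : ℕ) (hmn : m + 1 ≤ n)
    (G : Ω → Matrix (Fin m) (Fin n) ℍ[ℝ]) (hG : QuaternionGaussian.IsQuaternionGaussian P G)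
    (t : ℝ) (ht : 1 ≤ t) :
    P.real {ω | ‖QuaternionGaussian.pinv (G ω)‖ ^ 2 >
        3 * (m : ℝ) / (4 * ((n : ℝ) - (m : ℝ) + 1)) * t}
      ≤ t ^ (-2 * ((n : ℤ) - (m : ℤ))) := by
  obtain ⟨e, he⟩ := Nat.exists_eq_add_of_le hmn
  have hn : n = m + e + 1 := by omega
  have ht0 : 0 < t := by linarith
  have h := hG.measure_norm_pinv_sq_gt_le hn ht0
  have h1 : (n : ℝ) - m + 1 = e + 2 := by
    rw [hn]
    push_cast
    ring
  have h2 : t ^ (-2 * ((n : ℤ) - (m : ℤ))) = (t ^ (2 * e + 2))⁻¹ := by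
    rw [← zpow_natCast, ← zpow_neg, hn]
    congr 1
    push_cast
    ring
  rw [h1, h2]
  exact ENNReal.toReal_le_of_le_ofReal (by positivity) h
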